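/- Let $M$ be an $m$-dimensional differentiable (smooth) manifold and let $\mathbf{T}M=TM\oplus T^*M$ be its big tangent bundle, with the neutral metric $g((X,\alpha),(Y,\mu))=\alpha(Y)+\mu(X)$ and the Courant bracket $$[(X,\alpha),(Y,\mu)]=\Big([X,Y],\;L_X\mu-L_Y\alpha+\tfrac12 d(\alpha(Y)-\mu(X))\Big).$$ Let $G$ be a generalized Riemannian metric on $M$, i.e. $G(\mathcal X,\mathcal Y)=g(\phi\mathcal X,\mathcal Y)$ for a smooth bundle endomorphism $\phi$ of $\mathbf{T}M$ with $\phi^2=\mathrm{Id}$, $g(\phi\mathcal X,\phi\mathcal Y)=g(\mathcal X,\mathcal Y)$ and $G$ positive definite. Let $E\subset\mathbf{T}M$ be an almost Dirac structure, i.e. a smooth subbundle whose fibres are maximal $g$-isotropic; $E$ is called integrable if $\Gamma E$ is closed under the Courant bracket. Let $\Psi_E$ be the endomorphism of $\mathbf{T}M$ that equals $\mathrm{Id}$ on $E$ and $-\mathrm{Id}$ on the $G$-orthogonal complement $E^{\perp_G}$. A big connection is a smooth connection $\nabla$ on the vector bundle $\mathbf{T}M$ with $X(g(\mathcal Y,\mathcal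 Z))=g(\nabla_X\mathcal Y,\mathcal Z)+g(\mathcal Y,\nabla_X\mathcal Z)$; it preserves $E$ if $\nabla_X\mathcal Y\in\Gamma E$ for all vector fields $X$ and all $\mathcal Y\in\Gamma E$. For $\mathcal X=(X,\alpha)$ and $\mathcal Y=(Y,\mu)$ in $\Gamma\mathbf{T}M$ put $\nabla_{\mathcal X}=\nabla_X$ and $T^\nabla(\mathcal X,\mathcal Y)=\nabla_X\mathcal Y-\nabla_Y\mathcal X-[\mathcal X,\mathcal Y]$. The Gualtieri torsion of $\nabla$ is $$\mathcal T^\nabla(\mathcal X,\mathcal Y,\mathcal Z)=g(T^\nabla(\mathcal X,\mathcal Y),\mathcal Z)+\tfrac12\big[g(\nabla_{\mathcal Z}\mathcal X,\mathcal Y)-g(\nabla_{\mathcal Z}\mathcal Y,\mathcal X)\big].$$ Consider the condition $$\mathcal T^\nabla(\mathcal X,\mathcal Y,\mathcal Z)+\mathcal T^\nabla(\mathcal X,\Psi_E\mathcal Y,\mathcal Z)+\mathcal T^\nabla(\Psi_E\mathcal X,\mathcal Y,\mathcal Z)+\mathcal T^\nabla(\Psi_E\mathcal X,\Psi_E\mathcal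 Y,\mathcal Z)=0\qquad\forall\,\mathcal X,\mathcal Y\in\Gamma\mathbf{T}M,\ \mathcal Z\in\Gamma E.\tag{$*$}$$ If there exists a big connection $\nabla$ that preserves $E$ and satisfies $(*)$, then $E$ is integrable. Conversely, if $E$ is integrable, then $(*)$ holds for every big connection $\nabla$ that preserves $E$. -/

import Mathlib

open Bundle
open scoped Manifold ContDiff Bundle

noncomputable section

namespace GeneralizedGeometry

/-! ### The big tangent bundle -/

/-- The model fibre `ℝᵐ ⊕ (ℝᵐ)*` of the big tangent bundle. -/
abbrev BigModel (m : ℕ) : Type :=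
  EuclideanSpace ℝ (Fin m) × (EuclideanSpace ℝ (Fin m) →L[ℝ] ℝ)

/-- The cotangent bundle `T*M`, as the bundle of linear maps from `TM` to the trivial line bundle. -/
abbrev Cotangent (m : ℕ) (M : Type*) [TopologicalSpace M]
    [ChartedSpace (EuclideanSpace ℝ (Fin m)) M] : M → Type :=
  fun x => TangentSpace (𝓡 m) x →L[ℝ] Trivial M ℝ x

/-- The big tangent bundle `TM ⊕ T*M`. -/
abbrev BigTangent (m : ℕ) (M : Type*) [TopologicalSpace M]
    [ChartedSpace (EuclideanSpace ℝ (Fin m)) M] : M → Type :=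
  (fun x : M => TangentSpace (𝓡 m) x) ×ᵇ Cotangent m M

variable {m : ℕ} {M : Type*} [TopologicalSpace M] [ChartedSpace (EuclideanSpace ℝ (Fin m)) M]

/-- The neutral metric `g((X, α), (Y, μ)) = α(Y) + μ(X)` on a fibre of the big tangent bundle,
as a bilinear form. -/
def neutral (x : M) : LinearMap.BilinForm ℝ (BigTangent m M x) :=
  LinearMap.mk₂ ℝ (fun u v => (u.2 v.1 + v.2 u.1 : ℝ))
    (fun u u' v => by simp; ring) (fun c u v => by simp; ring)
    (fun u v v' => by simp; ring) (fun c u v => by simp; ring)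

/-- The total space of the big tangent bundle. -/
abbrev BigTangentTotal (m : ℕ) (M : Type*) [TopologicalSpace M]
    [ChartedSpace (EuclideanSpace ℝ (Fin m)) M] : Type _ :=
  TotalSpace (BigModel m) (BigTangent m M)

section Smooth

variable [IsManifold (𝓡 m) ∞ M]

/-- Smoothness on a set `U` of a (set-theoretic) section of the big tangent bundle. -/
def SmoothSectionOn (U : Set M) (s : Π x : M, BigTangent m M x) : Prop :=
  ContMDiffOn (𝓡 m) ((𝓡 m).prod 𝓘(ℝ, BigModel m)) ∞
    (fun x => (⟨x, s x⟩ : BigTangentTotal m M)) U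

/-- Global smooth sections of the big tangent bundle. -/
def SmoothSection (s : Π x : M, BigTangent m M x) : Prop :=
  ContMDiff (𝓡 m) ((𝓡 m).prod 𝓘(ℝ, BigModel m)) ∞
    (fun x => (⟨x, s x⟩ : BigTangentTotal m M))

end Smooth

/-! ### The Courant bracket -/

/-- The exterior derivative of a 1-form `μ` at `x`, computed in the preferred chart at `x`:
`dμ(u, v) = (∂_u μ)(v) - (∂_v μ)(u)`, where `μ` is read as a function with values in `(ℝᵐ)*`
through the coordinate frame of that chart. (The coordinate frame of the preferred chart at `x`
identifies `T_x M` with `ℝᵐ` by the identity map.) -/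
def extDer (μ : Π x : M, Cotangent m M x) [IsManifold (𝓡 m) 1 M] (x : M) :
    TangentSpace (𝓡 m) x →L[ℝ] TangentSpace (𝓡 m) x →L[ℝ] ℝ :=
  let D : EuclideanSpace ℝ (Fin m) →L[ℝ] EuclideanSpace ℝ (Fin m) →L[ℝ] ℝ :=
    mvfderiv (𝓡 m) (fun y : M => ContinuousLinearMap.inCoordinates
      (EuclideanSpace ℝ (Fin m)) (fun y : M => TangentSpace (𝓡 m) y) ℝ (Trivial M ℝ)
      x y x y (μ y)) x
  D - D.flip

/-- The Lie derivative of a 1-form along a vector field, `L_X μ = i(X) dμ + d(μ(X))`. -/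
def lieDerForm [IsManifold (𝓡 m) 1 M] (X : Π x : M, TangentSpace (𝓡 m) x)
    (μ : Π x : M, Cotangent m M x) (x : M) : TangentSpace (𝓡 m) x →L[ℝ] ℝ :=
  extDer μ x (X x) + mvfderiv (𝓡 m) (fun y : M => (μ y (X y) : ℝ)) x

/-- The Courant bracket
`[(X, α), (Y, μ)] = ([X, Y], L_X μ - L_Y α + ½ d(α(Y) - μ(X)))`. -/
def courant [IsManifold (𝓡 m) 1 M] (s t : Π x : M, BigTangent m M x) (x : M) :
    BigTangent m M x :=
  (VectorField.mlieBracket (𝓡 m) (fun y => (s y).1) (fun y => (t y).1) x,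
    lieDerForm (fun y => (s y).1) (fun y => (t y).2) x
      - lieDerForm (fun y => (t y).1) (fun y => (s y).2) x
      + (1 / 2 : ℝ) • mvfderiv (𝓡 m)
          (fun y : M => ((s y).2 (t y).1 - (t y).2 (s y).1 : ℝ)) x)

variable [IsManifold (𝓡 m) ∞ M]

/-! ### Generalized Riemannian metrics -/

variable (m M) in
/-- A generalized Riemannian metric, given by a smooth endomorphism `φ` of the big tangent bundle
with `φ² = Id`, `g(φ u, φ v) = g(u, v)` and such that `G(u, v) = g(φ u, v)` is positive definite. -/
structure GenRiemannianMetric where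
  phi : Π x : M, BigTangent m M x →ₗ[ℝ] BigTangent m M x
  smooth : ContMDiff ((𝓡 m).prod 𝓘(ℝ, BigModel m)) ((𝓡 m).prod 𝓘(ℝ, BigModel m)) ∞
    (fun p : BigTangentTotal m M => (⟨p.1, phi p.1 p.2⟩ : BigTangentTotal m M))
  phi_phi : ∀ x u, phi x (phi x u) = u
  isometry : ∀ x u v, neutral x (phi x u) (phi x v) = neutral x u v
  posDef : ∀ x u, u ≠ 0 → 0 < neutral x (phi x u) u

/-- The metric `G(u, v) = g(φ u, v)` on a fibre. -/
def GenRiemannianMetric.form (G : GenRiemannianMetric m M) (x : M) :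
    LinearMap.BilinForm ℝ (BigTangent m M x) :=
  (neutral x).comp (G.phi x) LinearMap.id

/-! ### Almost Dirac structures -/

/-- A subspace of a fibre of the big tangent bundle is `g`-isotropic if `g` vanishes on it. -/
def IsIsotropic (x : M) (W : Submodule ℝ (BigTangent m M x)) : Prop :=
  ∀ u ∈ W, ∀ v ∈ W, neutral x u v = 0

variable (m M) in
/-- An almost Dirac structure: a smooth subbundle of the big tangent bundle (a family of subspaces
of the fibres which locally has a smooth frame) whose fibres are maximal `g`-isotropic. -/
structure AlmostDirac where
  fiber : Π x : M, Submodule ℝ (BigTangent m M x)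
  locallyFramed : ∀ x₀ : M, ∃ U : Set M, IsOpen U ∧ x₀ ∈ U ∧
    ∃ (k : ℕ) (e : Fin k → Π x : M, BigTangent m M x),
      (∀ i, SmoothSectionOn U (e i)) ∧
      ∀ x ∈ U, LinearIndependent ℝ (fun i => e i x) ∧
        Submodule.span ℝ (Set.range fun i => e i x) = fiber x
  maximalIsotropic : ∀ x : M, Maximal (IsIsotropic x) (fiber x)

/-- The smooth sections of the almost Dirac structure `E`. -/
def AlmostDirac.IsSection (E : AlmostDirac m M) (s : Π x : M, BigTangent m M x) : Prop :=
  SmoothSection s ∧ ∀ x, s x ∈ E.fiber x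

/-- `E` is integrable if it is closed under the Courant bracket: the bracket of two smooth sections
of `E` takes its values in `E`. -/
def AlmostDirac.Integrable (E : AlmostDirac m M) : Prop :=
  ∀ s t : Π x : M, BigTangent m M x, E.IsSection s → E.IsSection t →
    ∀ x, courant s t x ∈ E.fiber x

/-- The fibre of the `G`-orthogonal complement `E' = E^{⊥_G}`. -/
def AlmostDirac.perp (E : AlmostDirac m M) (G : GenRiemannianMetric m M) (x : M) :
    Submodule ℝ (BigTangent m M x) :=
  (G.form x).orthogonal (E.fiber x)

theorem AlmostDirac.isCompl_perp (E : AlmostDirac m M) (G : GenRiemannianMetric m M) (x : M) :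
    IsCompl (E.fiber x) (E.perp G x) := by
  have : FiniteDimensional ℝ (BigTangent m M x) :=
    inferInstanceAs (FiniteDimensional ℝ (BigModel m))
  have hrefl : (G.form x).IsRefl := by
    intro u v h
    have h1 : neutral x (G.phi x u) v = 0 := h
    have h2 := G.isometry x (G.phi x u) v
    rw [G.phi_phi, h1] at h2
    change neutral x (G.phi x v) u = 0
    rw [← h2]
    simp only [neutral, LinearMap.mk₂_apply]
    ring
  refine (LinearMap.BilinForm.isCompl_orthogonal_iff_disjoint hrefl).2 ?_
  refine Submodule.disjoint_def.2 fun u hu hu' => ?_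
  by_contra hne
  have h1 : neutral x (G.phi x u) u = 0 := hu' u hu
  exact (G.posDef x u hne).ne' h1

/-- The generalized almost paracomplex structure `Ψ_E`: the endomorphism equal to `Id` on `E` and
to `-Id` on `E' = E^{⊥_G}`. -/
def AlmostDirac.para (E : AlmostDirac m M) (G : GenRiemannianMetric m M) (x : M) :
    BigTangent m M x →ₗ[ℝ] BigTangent m M x :=
  (E.fiber x).projection (E.perp G x) (E.isCompl_perp G x)
    - (E.perp G x).projection (E.fiber x) (E.isCompl_perp G x).symm

/-! ### Big connections -/

variable (m M) in
/-- A big connection: a smooth connection `∇` on the big tangent bundle which is compatible with the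
neutral metric `g`. The value of `∇_X s` at `x` is `cov s x (X x)`. -/
structure BigConnection where
  cov : CovariantDerivative (𝓡 m) (BigModel m) (BigTangent m M)
  smooth : CovariantDerivative.ContMDiffCovariantDerivative cov ∞
  metric : ∀ s t : Π x : M, BigTangent m M x, SmoothSection s → SmoothSection t →
    ∀ (x : M) (v : TangentSpace (𝓡 m) x),
      mvfderiv (𝓡 m) (fun y : M => neutral y (s y) (t y)) x v
        = neutral x (cov s x v) (t x) + neutral x (s x) (cov t x v)

/-- `∇` preserves `E` if `∇_X s` is a section of `E` for every section `s` of `E`. -/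
def BigConnection.Preserves (D : BigConnection m M) (E : AlmostDirac m M) : Prop :=
  ∀ s : Π x : M, BigTangent m M x, E.IsSection s →
    ∀ (x : M) (v : TangentSpace (𝓡 m) x), D.cov s x v ∈ E.fiber x

/-- The Courant torsion `T(s, t) = ∇_{pr s} t - ∇_{pr t} s - [s, t]`. -/
def BigConnection.courantTorsion (D : BigConnection m M) (s t : Π x : M, BigTangent m M x)
    (x : M) : BigTangent m M x :=
  D.cov t x (s x).1 - D.cov s x (t x).1 - courant s t x

/-- The Gualtieri torsion
`𝒯(s, t, r) = g(T(s, t), r) + ½ (g(∇_{pr r} s, t) - g(∇_{pr r} t, s))`. -/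
def BigConnection.gualtieriTorsion (D : BigConnection m M) (s t r : Π x : M, BigTangent m M x)
    (x : M) : ℝ :=
  neutral x (D.courantTorsion s t x) (r x)
    + (1 / 2) * (neutral x (D.cov s x (r x).1) (t x) - neutral x (D.cov t x (r x).1) (s x))

/-- The torsion identity
`𝒯(s, t, r) + 𝒯(s, Ψ_E t, r) + 𝒯(Ψ_E s, t, r) + 𝒯(Ψ_E s, Ψ_E t, r) = 0`
for all smooth sections `s`, `t` of the big tangent bundle and all smooth sections `r` of `E`. -/
def BigConnection.TorsionIdentity (D : BigConnection m M) (G : GenRiemannianMetric m M)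
    (E : AlmostDirac m M) : Prop :=
  ∀ s t r : Π x : M, BigTangent m M x, SmoothSection s → SmoothSection t → E.IsSection r →
    ∀ x : M,
      D.gualtieriTorsion s t r x
        + D.gualtieriTorsion s (fun y => E.para G y (t y)) r x
        + D.gualtieriTorsion (fun y => E.para G y (s y)) t r x
        + D.gualtieriTorsion (fun y => E.para G y (s y)) (fun y => E.para G y (t y)) r x = 0

end GeneralizedGeometry

end

/-!
Maximal isotropic fibres are Lagrangian, `E^⊥ = E`, so `E` is integrable if and only if
`g([s, t], r) = 0` for all sections `s`, `t`, `r` of `E`. If `∇` preserves `E`, every covariant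
derivative in the Gualtieri torsion of such sections is paired with a section of `E`, which leaves
`𝒯(s, t, r) = -g([s, t], r)`. Finally `𝒯` is biadditive in its first two arguments, so the left
side of the torsion identity is `𝒯(s + Ψs, t + Ψt, r)`; here `s + Ψs` is a section of `E`, equal to
`2s` when `s` already is one.
-/

namespace GeneralizedGeometry

section LinearAlgebra

variable {K V : Type*} [Field K] [AddCommGroup V] [Module K V] {B : LinearMap.BilinForm K V}

theorem isotropic_sup_inf_orthogonal (hB : B.IsRefl) {W L : Submodule K V}
    (hW : W ≤ B.orthogonal W) (hL : L ≤ B.orthogonal L) :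
    W ⊔ B.orthogonal W ⊓ L ≤ B.orthogonal (W ⊔ B.orthogonal W ⊓ L) := by
  intro u hu v hv
  obtain ⟨w, hw, l, ⟨hlW, hlL⟩, rfl⟩ := Submodule.mem_sup.1 hu
  obtain ⟨w', hw', l', ⟨hlW', hlL'⟩, rfl⟩ := Submodule.mem_sup.1 hv
  have hww : B w' w = 0 := hW hw w' hw'
  have hwl : B w' l = 0 := hlW w' hw'
  have hlw : B l' w = 0 := hB _ _ (hlW' w hw)
  have hll : B l' l = 0 := hL hlL l' hlL'
  simp only [map_add, LinearMap.add_apply, hww, hwl, hlw, hll, add_zero]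

theorem orthogonal_eq_self_of_maximal_isotropic [FiniteDimensional K V] (hB : B.IsRefl)
    (hnd : B.Nondegenerate) {L W : Submodule K V} (hL : B.orthogonal L = L)
    (hW : Maximal (fun U => U ≤ B.orthogonal U) W) : B.orthogonal W = W := by
  -- By maximality `(W + L)^⊥ = W^⊥ ∩ L` is contained in `W`; dually, `W^⊥ ≤ W + L`.
  have inf_le : B.orthogonal W ⊓ L ≤ W := le_sup_right.trans <|
    hW.le_of_ge (isotropic_sup_inf_orthogonal hB hW.prop hL.ge) le_sup_left
  refine le_antisymm (fun u hu => ?_) hW.prop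
  have mem_sup : u ∈ W ⊔ L := by
    rw [← LinearMap.BilinForm.orthogonal_orthogonal hnd hB (W ⊔ L)]
    intro v hv
    have hvL : v ∈ L := hL.le (LinearMap.BilinForm.orthogonal_le le_sup_right hv)
    exact hu v (inf_le ⟨LinearMap.BilinForm.orthogonal_le le_sup_left hv, hvL⟩)
  obtain ⟨w, hw, l, hl, rfl⟩ := Submodule.mem_sup.1 mem_sup
  exact add_mem hw (inf_le ⟨(add_mem_cancel_left (hW.prop hw)).1 hu, hl⟩)

end LinearAlgebra

section Fibre

variable {m : ℕ} {M : Type*} [TopologicalSpace M] [ChartedSpace (EuclideanSpace ℝ (Fin m)) M]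
  {x : M}

theorem neutral_comm (u v : BigTangent m M x) : neutral x u v = neutral x v u :=
  add_comm _ _

theorem neutral_isRefl : (neutral (m := m) x).IsRefl := fun u v h => (neutral_comm v u).trans h

theorem neutral_nondegenerate : (neutral (m := m) x).Nondegenerate := by
  refine (LinearMap.IsRefl.nondegenerate_iff_separatingLeft neutral_isRefl).2 fun u hu => ?_
  have hfst : u.1 = 0 := by
    let w : EuclideanSpace ℝ (Fin m) := u.1
    have h : u.2 0 + inner ℝ w w = (0 : ℝ) := hu (0, innerSL ℝ w)
    rwa [map_zero, zero_add, inner_self_eq_zero] at h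
  refine Prod.ext hfst (ContinuousLinearMap.ext fun v => ?_)
  have h : u.2 v + (0 : TangentSpace (𝓡 m) x →L[ℝ] ℝ) u.1 = 0 := hu (v, 0)
  simpa using h

theorem orthogonal_ker_snd :
    (neutral x).orthogonal (LinearMap.ker (LinearMap.snd ℝ (TangentSpace (𝓡 m) x)
      (Cotangent m M x))) = LinearMap.ker (LinearMap.snd ℝ _ _) := by
  ext u
  constructor
  · intro hu
    refine ContinuousLinearMap.ext fun v => ?_
    have h : (0 : TangentSpace (𝓡 m) x →L[ℝ] ℝ) u.1 + u.2 v = 0 := hu (v, 0) rfl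
    simpa using h
  · intro hu v hv
    change v.2 u.1 + u.2 v.1 = (0 : ℝ)
    rw [show v.2 = 0 from hv, show u.2 = 0 from hu]
    exact add_zero 0

theorem AlmostDirac.orthogonal_fiber [IsManifold (𝓡 m) ∞ M] (E : AlmostDirac m M) (x : M) :
    (neutral x).orthogonal (E.fiber x) = E.fiber x := by
  have : FiniteDimensional ℝ (BigTangent m M x) :=
    inferInstanceAs (FiniteDimensional ℝ (BigModel m))
  refine orthogonal_eq_self_of_maximal_isotropic neutral_isRefl neutral_nondegenerate
    orthogonal_ker_snd ?_
  have isIsotropic_eq : IsIsotropic x = fun U : Submodule ℝ (BigTangent m M x) =>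
      U ≤ (neutral x).orthogonal U :=
    funext fun U => propext ⟨fun h u hu v hv => h v hv u hu, fun h u hu v hv => h hv u hu⟩
  exact isIsotropic_eq ▸ E.maximalIsotropic x

end Fibre

section VectorBundle

open Filter Topology

variable {𝕜 : Type*} [NontriviallyNormedField 𝕜] {H : Type*} [TopologicalSpace H]
  {EM : Type*} [NormedAddCommGroup EM] [NormedSpace 𝕜 EM] {I : ModelWithCorners 𝕜 EM H}
  {M : Type*} [TopologicalSpace M] [ChartedSpace H M] {n : ℕ∞ω} {ι κ : Type*}
  {F : Type*} [NormedAddCommGroup F] [NormedSpace 𝕜 F]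

theorem contMDiffAt_coeff_of_eventuallyEq_sum_smul [CompleteSpace 𝕜] [FiniteDimensional 𝕜 F]
    [Fintype ι] {v : ι → M → F} {c : ι → M → 𝕜} {f : M → F} {x : M}
    (hv : ∀ i, ContMDiffAt I 𝓘(𝕜, F) n (v i) x) (hf : ContMDiffAt I 𝓘(𝕜, F) n f x)
    (hli : LinearIndependent 𝕜 fun i => v i x) (hfc : f =ᶠ[𝓝 x] fun y => ∑ i, c i y • v i y)
    (i : ι) : ContMDiffAt I 𝓘(𝕜, 𝕜) n (c i) x := by
  -- With `A y` the frame at `y` and `P` a left inverse of `A x`, the map `P ∘ A y` is invertible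
  -- near `x`, and there the coefficients are `(P ∘ A y)⁻¹ (P (f y))`.
  let A : M → (ι → 𝕜) →L[𝕜] F := fun y => ∑ i, (ContinuousLinearMap.proj i).smulRight (v i y)
  have A_apply (y : M) (d : ι → 𝕜) : A y d = ∑ i, d i • v i y := by simp [A]
  have hA : ContMDiffAt I 𝓘(𝕜, (ι → 𝕜) →L[𝕜] F) n A x := contMDiffAt_finsetSum fun i _ =>
    (ContinuousLinearMap.smulRightL 𝕜 (ι → 𝕜) F (.proj i)).contMDiff.contMDiffAt.comp x (hv i)
  obtain ⟨P, hP⟩ := (A x : (ι → 𝕜) →ₗ[𝕜] F).exists_leftInverse_of_injective <|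
    LinearMap.ker_eq_bot'.2 fun d hd =>
      funext <| Fintype.linearIndependent_iff.1 hli d ((A_apply x d).symm.trans hd)
  let B : M → (ι → 𝕜) →L[𝕜] (ι → 𝕜) := fun y => P.toContinuousLinearMap ∘L A y
  have hB : ContMDiffAt I 𝓘(𝕜, (ι → 𝕜) →L[𝕜] (ι → 𝕜)) n B x :=
    contMDiffAt_const.clm_comp hA
  have hBx : B x = ContinuousLinearMap.id 𝕜 (ι → 𝕜) :=
    ContinuousLinearMap.coe_injective hP
  have hB_inv : ContMDiffAt I 𝓘(𝕜, (ι → 𝕜) →L[𝕜] (ι → 𝕜)) n (fun y => (B y).inverse) x :=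
    ContMDiffAt.comp x (ContDiffAt.contMDiffAt
      (ContinuousLinearMap.IsInvertible.contDiffAt_map_inverse ⟨.refl 𝕜 _, hBx.symm⟩)) hB
  have hB_isInvertible : ∀ᶠ y in 𝓝 x, (B y).IsInvertible :=
    hB.continuousAt.eventually_mem <| by
      rw [hBx]
      exact ContinuousLinearEquiv.nhds (.refl 𝕜 (ι → 𝕜))
  have hc : (fun y => (B y).inverse (P.toContinuousLinearMap (f y))) =ᶠ[𝓝 x] fun y i => c i y := by
    filter_upwards [hB_isInvertible, hfc] with y hy hfy
    rw [hy.inverse_apply_eq, hfy, ← A_apply y fun i => c i y]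
    rfl
  have hcs : ContMDiffAt I 𝓘(𝕜, ι → 𝕜) n (fun y i => c i y) x :=
    (hB_inv.clm_apply (P.toContinuousLinearMap.contMDiff.contMDiffAt.comp x hf)
      ).congr_of_eventuallyEq hc.symm
  exact contMDiffAt_pi_space.1 hcs i

variable {V : M → Type*} [TopologicalSpace (TotalSpace F V)] [∀ x, AddCommGroup (V x)]
  [∀ x, Module 𝕜 (V x)] [∀ x, TopologicalSpace (V x)] [FiberBundle F V] [VectorBundle 𝕜 F V]

theorem contMDiffAt_coeff_of_section_eventuallyEq_sum_smul [CompleteSpace 𝕜]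
    [FiniteDimensional 𝕜 F] [Fintype ι] {s : ι → Π x, V x} {c : ι → M → 𝕜} {t : Π x, V x} {x : M}
    (hs : ∀ i, CMDiffAt n (T% (s i)) x) (ht : CMDiffAt n (T% t) x)
    (hli : LinearIndependent 𝕜 fun i => s i x)
    (htc : ∀ᶠ y in 𝓝 x, t y = ∑ i, c i y • s i y) (i : ι) : ContMDiffAt I 𝓘(𝕜, 𝕜) n (c i) x := by
  let e := trivializationAt F V x
  have hx : x ∈ e.baseSet := FiberBundle.mem_baseSet_trivializationAt F V x
  refine contMDiffAt_coeff_of_eventuallyEq_sum_smul (v := fun i y => (e ⟨y, s i y⟩).2)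
    (fun i => (contMDiffAt_section x).1 (hs i)) ((contMDiffAt_section x).1 ht) ?_ ?_ i
  · simpa [Function.comp_def] using
      hli.map' (e.linearEquivAt 𝕜 x hx : V x →ₗ[𝕜] F) (LinearEquiv.ker _)
  · filter_upwards [htc, e.open_baseSet.mem_nhds hx] with y hty hy
    change (e ⟨y, t y⟩).2 = ∑ i, c i y • (e ⟨y, s i y⟩).2
    simp only [← e.linearEquivAt_apply (R := 𝕜) y hy, hty, map_sum, map_smul]

theorem contMDiffAt_section_of_add_of_mem_span [CompleteSpace 𝕜]
    [FiniteDimensional 𝕜 F] [Finite ι] [Finite κ] {s : ι → Π x, V x} {s' : κ → Π x, V x}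
    {p q : Π x, V x} {x : M} (hs : ∀ i, CMDiffAt n (T% (s i)) x)
    (hs' : ∀ i, CMDiffAt n (T% (s' i)) x)
    (hli : LinearIndependent 𝕜 (Sum.elim (fun i => s i x) fun i => s' i x))
    (hp : ∀ᶠ y in 𝓝 x, p y ∈ Submodule.span 𝕜 (Set.range fun i => s i y))
    (hq : ∀ᶠ y in 𝓝 x, q y ∈ Submodule.span 𝕜 (Set.range fun i => s' i y))
    (hpq : CMDiffAt n (T% (p + q)) x) : CMDiffAt n (T% p) x := by
  cases nonempty_fintype ι
  cases nonempty_fintype κ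
  obtain ⟨c, hc⟩ := (hp.mono fun y => (Submodule.mem_span_range_iff_exists_fun 𝕜).1).choice
  obtain ⟨c', hc'⟩ := (hq.mono fun y => (Submodule.mem_span_range_iff_exists_fun 𝕜).1).choice
  have hli_elim : LinearIndependent 𝕜 fun j => Sum.elim s s' j x := by
    convert hli using 1
    exact funext (Sum.rec (fun _ => rfl) fun _ => rfl)
  have hsum_elim : ∀ᶠ y in 𝓝 x, (p + q) y =
      ∑ j, Sum.elim (fun i y => c y i) (fun i y => c' y i) j y • Sum.elim s s' j y := by
    filter_upwards [hc, hc'] with y hy hy'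
    simp [hy, hy']
  have hcs : ∀ i, ContMDiffAt I 𝓘(𝕜, 𝕜) n (fun y => c y i) x := fun i =>
    contMDiffAt_coeff_of_section_eventuallyEq_sum_smul (s := Sum.elim s s')
      (c := Sum.elim (fun i y => c y i) fun i y => c' y i) (Sum.rec hs hs') hpq hli_elim
      hsum_elim (.inl i)
  have hsum : CMDiffAt n (T% fun y => ∑ i, c y i • s i y) x :=
    .sum_section fun i _ => (hcs i).smul_section (hs i)
  refine hsum.congr_of_eventuallyEq ?_
  filter_upwards [hc] with y hy
  rw [hy]

end VectorBundle

theorem exists_contMDiff_smul_section {EM : Type*} [NormedAddCommGroup EM] [NormedSpace ℝ EM]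
    [FiniteDimensional ℝ EM] {H : Type*} [TopologicalSpace H] {I : ModelWithCorners ℝ EM H}
    {M : Type*} [TopologicalSpace M] [ChartedSpace H M] [T2Space M] [IsManifold I ∞ M]
    {F : Type*} [NormedAddCommGroup F] [NormedSpace ℝ F]
    {V : M → Type*} [TopologicalSpace (TotalSpace F V)] [∀ x, AddCommGroup (V x)]
    [∀ x, Module ℝ (V x)] [∀ x, TopologicalSpace (V x)] [FiberBundle F V] [VectorBundle ℝ F V]
    {U : Set M} (hU : IsOpen U) {x : M} (hx : x ∈ U) {s : Π x, V x} (hs : CMDiff[U] ∞ (T% s)) :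
    ∃ ρ : M → ℝ, ρ x = 1 ∧ (∀ y ∉ U, ρ y = 0) ∧ CMDiff ∞ (T% fun y => ρ y • s y) := by
  obtain ⟨f, -, hf⟩ := (SmoothBumpFunction.nhds_basis_tsupport (I := I) x).mem_iff.1
    (hU.mem_nhds hx)
  exact ⟨f, f.eq_one, fun y hy => image_eq_zero_of_notMem_tsupport fun h => hy (hf h),
    ContMDiffOn.smul_section_of_tsupport f.contMDiff.contMDiffOn hU hf hs⟩

section Paracomplex

variable {m : ℕ} {M : Type*} [TopologicalSpace M] [ChartedSpace (EuclideanSpace ℝ (Fin m)) M]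
  [IsManifold (𝓡 m) ∞ M]

/-- Smoothness at a point of a section of the big tangent bundle. -/
def SmoothSectionAt (s : Π x : M, BigTangent m M x) (x : M) : Prop :=
  ContMDiffAt (𝓡 m) ((𝓡 m).prod 𝓘(ℝ, BigModel m)) ∞
    (fun y => (⟨y, s y⟩ : BigTangentTotal m M)) x

theorem GenRiemannianMetric.smoothSectionAt_phi (G : GenRiemannianMetric m M)
    {s : Π x : M, BigTangent m M x} {x : M} (hs : SmoothSectionAt s x) :
    SmoothSectionAt (fun y => G.phi y (s y)) x :=
  (G.smooth ⟨x, s x⟩).comp x (f := fun y => (⟨y, s y⟩ : BigTangentTotal m M)) hs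

theorem AlmostDirac.perp_eq_map_phi (E : AlmostDirac m M) (G : GenRiemannianMetric m M) (x : M) :
    E.perp G x = (E.fiber x).map (G.phi x) := by
  have mem_perp_iff (u : BigTangent m M x) : u ∈ E.perp G x ↔ G.phi x u ∈ E.fiber x := by
    rw [← E.orthogonal_fiber x]
    refine forall₂_congr fun v _ => ?_
    rw [← G.isometry, G.phi_phi]
    rfl
  ext u
  rw [mem_perp_iff, Submodule.mem_map]
  exact ⟨fun hu => ⟨_, hu, G.phi_phi x u⟩, by rintro ⟨v, hv, rfl⟩; rwa [G.phi_phi]⟩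

theorem AlmostDirac.para_of_mem (E : AlmostDirac m M) (G : GenRiemannianMetric m M)
    {x : M} {u : BigTangent m M x} (hu : u ∈ E.fiber x) : E.para G x u = u := by
  rw [para, LinearMap.sub_apply, Submodule.projection_apply_of_mem_left _ hu,
    (Submodule.projection_apply_eq_zero_iff _).2 hu, sub_zero]

theorem AlmostDirac.add_para_mem (E : AlmostDirac m M) (G : GenRiemannianMetric m M)
    {x : M} (u : BigTangent m M x) : u + E.para G x u ∈ E.fiber x := by
  have h := E.isCompl_perp G x
  have hu : u + E.para G x u
      = (2 : ℝ) • (E.fiber x).projection (E.perp G x) h u := by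
    nth_rw 1 [← Submodule.projection_add_projection_eq_self h u]
    rw [para, LinearMap.sub_apply]
    module
  rw [hu]
  exact Submodule.smul_mem _ _ (Submodule.projection_apply_mem h u)

theorem AlmostDirac.smoothSectionAt_projection (E : AlmostDirac m M) (G : GenRiemannianMetric m M)
    {s : Π x : M, BigTangent m M x} {x : M} (hs : SmoothSectionAt s x) :
    SmoothSectionAt
      (fun y => (E.fiber y).projection (E.perp G y) (E.isCompl_perp G y) (s y)) x := by
  obtain ⟨U, hU, hx, k, e, he, hspan⟩ := E.locallyFramed x
  have he' (i : Fin k) : SmoothSectionAt (e i) x := (he i).contMDiffAt (hU.mem_nhds hx)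
  have perp_eq_span (y : M) (hy : y ∈ U) :
      E.perp G y = Submodule.span ℝ (Set.range fun i => G.phi y (e i y)) := by
    rw [E.perp_eq_map_phi, ← (hspan y hy).2, Submodule.map_span, ← Set.range_comp]
    rfl
  have linearIndependent_phi : LinearIndependent ℝ fun i => G.phi x (e i x) :=
    (hspan x hx).1.map_injOn _ (Function.LeftInverse.injective (G.phi_phi x)).injOn
  let p : Π y : M, BigTangent m M y := fun y =>
    (E.fiber y).projection (E.perp G y) (E.isCompl_perp G y) (s y)
  let q : Π y : M, BigTangent m M y := fun y =>
    (E.perp G y).projection (E.fiber y) (E.isCompl_perp G y).symm (s y)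
  have p_add_q : p + q = s := funext fun y =>
    Submodule.projection_add_projection_eq_self (E.isCompl_perp G y) (s y)
  refine contMDiffAt_section_of_add_of_mem_span (p := p) (q := q) (s := e)
    (s' := fun i y => G.phi y (e i y)) he' (fun i => G.smoothSectionAt_phi (he' i)) ?_ ?_ ?_ ?_
  · refine (hspan x hx).1.sum_type linearIndependent_phi ?_
    rw [(hspan x hx).2, ← perp_eq_span x hx]
    exact (E.isCompl_perp G x).disjoint
  · filter_upwards [hU.mem_nhds hx] with y hy
    rw [(hspan y hy).2]
    exact Submodule.projection_apply_mem _ _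
  · filter_upwards [hU.mem_nhds hx] with y hy
    rw [← perp_eq_span y hy]
    exact Submodule.projection_apply_mem _ _
  · rw [p_add_q]
    exact hs

theorem AlmostDirac.smoothSection_para (E : AlmostDirac m M) (G : GenRiemannianMetric m M)
    {s : Π x : M, BigTangent m M x} (hs : SmoothSection s) :
    SmoothSection fun x => E.para G x (s x) := by
  let p : Π x : M, BigTangent m M x := fun x =>
    (E.fiber x).projection (E.perp G x) (E.isCompl_perp G x) (s x)
  have para_eq : (fun x => E.para G x (s x)) = p - (s - p) := by
    funext x
    rw [para, LinearMap.sub_apply,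
      Submodule.projection_eq_self_sub_projection (E.isCompl_perp G x)]
    rfl
  rw [para_eq]
  intro x
  have hp : SmoothSectionAt p x := E.smoothSectionAt_projection G (hs x)
  exact ContMDiffAt.sub_section hp (ContMDiffAt.sub_section (hs x) hp)

end Paracomplex

section Courant

variable {m : ℕ} {M : Type*} [TopologicalSpace M] [ChartedSpace (EuclideanSpace ℝ (Fin m)) M]
  [IsManifold (𝓡 m) 1 M] {x : M}

/-- Differentiability at a point of a vector field. -/
def DifferentiableVectorFieldAt (X : Π x : M, TangentSpace (𝓡 m) x) (x : M) : Prop :=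
  MDifferentiableAt (𝓡 m) ((𝓡 m).prod 𝓘(ℝ, EuclideanSpace ℝ (Fin m)))
    (fun y => (⟨y, X y⟩ : TotalSpace (EuclideanSpace ℝ (Fin m)) (TangentSpace (𝓡 m) (M := M)))) x

/-- Differentiability at a point of a 1-form. -/
def DifferentiableFormAt (μ : Π x : M, Cotangent m M x) (x : M) : Prop :=
  MDifferentiableAt (𝓡 m) ((𝓡 m).prod 𝓘(ℝ, EuclideanSpace ℝ (Fin m) →L[ℝ] ℝ))
    (fun y => (⟨y, μ y⟩ : TotalSpace (EuclideanSpace ℝ (Fin m) →L[ℝ] ℝ) (Cotangent m M))) x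

/-- Differentiability at a point of a section of the big tangent bundle. -/
def DifferentiableSectionAt (s : Π x : M, BigTangent m M x) (x : M) : Prop :=
  MDifferentiableAt (𝓡 m) ((𝓡 m).prod 𝓘(ℝ, BigModel m))
    (fun y => (⟨y, s y⟩ : BigTangentTotal m M)) x

theorem DifferentiableSectionAt.fst {s : Π x : M, BigTangent m M x}
    (hs : DifferentiableSectionAt s x) :
    DifferentiableVectorFieldAt (fun y => (s y).1) x :=
  (mdifferentiableAt_section _ _).2 <| (ContinuousLinearMap.fst ℝ (EuclideanSpace ℝ (Fin m))
    (EuclideanSpace ℝ (Fin m) →L[ℝ] ℝ)).mdifferentiableAt.comp x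
      ((mdifferentiableAt_section _ _).1 hs)

theorem DifferentiableSectionAt.snd {s : Π x : M, BigTangent m M x}
    (hs : DifferentiableSectionAt s x) : DifferentiableFormAt (fun y => (s y).2) x :=
  (mdifferentiableAt_section _ _).2 <| (ContinuousLinearMap.snd ℝ (EuclideanSpace ℝ (Fin m))
    (EuclideanSpace ℝ (Fin m) →L[ℝ] ℝ)).mdifferentiableAt.comp x
      ((mdifferentiableAt_section _ _).1 hs)

theorem DifferentiableSectionAt.add {s t : Π x : M, BigTangent m M x}
    (hs : DifferentiableSectionAt s x) (ht : DifferentiableSectionAt t x) :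
    DifferentiableSectionAt (s + t) x :=
  mdifferentiableAt_add_section hs ht

theorem DifferentiableFormAt.mdifferentiableAt_apply {μ : Π x : M, Cotangent m M x}
    {X : Π x : M, TangentSpace (𝓡 m) x} (hμ : DifferentiableFormAt μ x)
    (hX : DifferentiableVectorFieldAt X x) :
    MDifferentiableAt (𝓡 m) 𝓘(ℝ, ℝ) (fun y => (μ y (X y) : ℝ)) x :=
  (mdifferentiableAt_section _ _).1 <| MDifferentiableAt.clm_bundle_apply
    (F₁ := EuclideanSpace ℝ (Fin m)) (F₂ := ℝ) (E₁ := fun x : M => TangentSpace (𝓡 m) x)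
    (E₂ := Trivial M ℝ) (b := fun x : M => x) hμ hX

theorem extDer_add {μ ν : Π x : M, Cotangent m M x} (hμ : DifferentiableFormAt μ x)
    (hν : DifferentiableFormAt ν x) : extDer (μ + ν) x = extDer μ x + extDer ν x := by
  let inCoord (θ : Π x : M, Cotangent m M x) (y : M) : EuclideanSpace ℝ (Fin m) →L[ℝ] ℝ :=
    ContinuousLinearMap.inCoordinates (EuclideanSpace ℝ (Fin m))
      (fun y : M => TangentSpace (𝓡 m) y) ℝ (Trivial M ℝ) x y x y (θ y)
  have inCoord_add : inCoord (μ + ν) = inCoord μ + inCoord ν := by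
    funext y
    simp [inCoord, ContinuousLinearMap.inCoordinates]
  have mvfderiv_inCoord_add : mvfderiv (𝓡 m) (inCoord (μ + ν)) x
      = mvfderiv (𝓡 m) (inCoord μ) x + mvfderiv (𝓡 m) (inCoord ν) x := by
    rw [inCoord_add]
    exact mvfderiv_add ((mdifferentiableAt_hom_bundle _).1 hμ).2
      ((mdifferentiableAt_hom_bundle _).1 hν).2
  ext u v
  change mvfderiv (𝓡 m) (inCoord (μ + ν)) x u v - mvfderiv (𝓡 m) (inCoord (μ + ν)) x v u
    = mvfderiv (𝓡 m) (inCoord μ) x u v - mvfderiv (𝓡 m) (inCoord μ) x v u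
      + (mvfderiv (𝓡 m) (inCoord ν) x u v - mvfderiv (𝓡 m) (inCoord ν) x v u)
  rw [mvfderiv_inCoord_add]
  exact add_sub_add_comm _ _ _ _

theorem lieDerForm_add_left {X Y : Π x : M, TangentSpace (𝓡 m) x} {μ : Π x : M, Cotangent m M x}
    (hX : DifferentiableVectorFieldAt X x) (hY : DifferentiableVectorFieldAt Y x)
    (hμ : DifferentiableFormAt μ x) :
    lieDerForm (X + Y) μ x = lieDerForm X μ x + lieDerForm Y μ x := by
  have mvfderiv_apply_add : mvfderiv (𝓡 m) (fun y => (μ y ((X + Y) y) : ℝ)) x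
      = mvfderiv (𝓡 m) (fun y => (μ y (X y) : ℝ)) x
        + mvfderiv (𝓡 m) (fun y => (μ y (Y y) : ℝ)) x := by
    rw [← mvfderiv_add (hμ.mdifferentiableAt_apply hX) (hμ.mdifferentiableAt_apply hY)]
    congr 1
    exact funext fun y => map_add (μ y) (X y) (Y y)
  rw [lieDerForm, mvfderiv_apply_add, Pi.add_apply, map_add, add_add_add_comm]
  rfl

theorem lieDerForm_add_right {X : Π x : M, TangentSpace (𝓡 m) x} {μ ν : Π x : M, Cotangent m M x}
    (hX : DifferentiableVectorFieldAt X x) (hμ : DifferentiableFormAt μ x)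
    (hν : DifferentiableFormAt ν x) :
    lieDerForm X (μ + ν) x = lieDerForm X μ x + lieDerForm X ν x := by
  have mvfderiv_apply_add : mvfderiv (𝓡 m) (fun y => ((μ + ν) y (X y) : ℝ)) x
      = mvfderiv (𝓡 m) (fun y => (μ y (X y) : ℝ)) x
        + mvfderiv (𝓡 m) (fun y => (ν y (X y) : ℝ)) x :=
    mvfderiv_add (hμ.mdifferentiableAt_apply hX) (hν.mdifferentiableAt_apply hX)
  rw [lieDerForm, mvfderiv_apply_add, extDer_add hμ hν, add_apply, add_add_add_comm]
  rfl

theorem courant_swap (s t : Π x : M, BigTangent m M x) (x : M) :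
    courant s t x = -courant t s x := by
  have mvfderiv_sub_swap : mvfderiv (𝓡 m) (fun y => ((s y).2 (t y).1 - (t y).2 (s y).1 : ℝ)) x
      = -mvfderiv (𝓡 m) (fun y => ((t y).2 (s y).1 - (s y).2 (t y).1 : ℝ)) x := by
    rw [← mvfderiv_neg]
    congr 1
    exact funext fun y => (neg_sub _ _).symm
  refine Prod.ext VectorField.mlieBracket_swap_apply ?_
  rw [courant, mvfderiv_sub_swap, courant, Prod.snd_neg]
  module

variable (nabla : CovariantDerivative (𝓡 m) (BigModel m) (BigTangent m M))

/-- The Courant torsion of an arbitrary connection on the big tangent bundle; for a big connection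
it is `BigConnection.courantTorsion`. -/
noncomputable def courantTorsion (s t : Π x : M, BigTangent m M x) (x : M) : BigTangent m M x :=
  nabla t x (s x).1 - nabla s x (t x).1 - courant s t x

/-- The Gualtieri torsion of an arbitrary connection on the big tangent bundle; for a big
connection it is `BigConnection.gualtieriTorsion`. -/
noncomputable def gualtieriTorsion (s t r : Π x : M, BigTangent m M x) (x : M) : ℝ :=
  neutral x (courantTorsion nabla s t x) (r x)
    + (1 / 2) * (neutral x (nabla s x (r x).1) (t x) - neutral x (nabla t x (r x).1) (s x))

variable {nabla}

theorem gualtieriTorsion_swap (s t r : Π x : M, BigTangent m M x) (x : M) :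
    gualtieriTorsion nabla s t r x = -gualtieriTorsion nabla t s r x := by
  have courantTorsion_swap : courantTorsion nabla s t x = -courantTorsion nabla t s x := by
    rw [courantTorsion, courantTorsion, courant_swap s t]
    module
  rw [gualtieriTorsion, gualtieriTorsion, courantTorsion_swap, map_neg, LinearMap.neg_apply]
  ring

end Courant

section Additivity

variable {m : ℕ} {M : Type*} [TopologicalSpace M] [ChartedSpace (EuclideanSpace ℝ (Fin m)) M]
  [IsManifold (𝓡 m) 2 M] {nabla : CovariantDerivative (𝓡 m) (BigModel m) (BigTangent m M)}
  {x : M} {s s' t t' : Π x : M, BigTangent m M x}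

theorem courant_add_right (hs : DifferentiableSectionAt s x)
    (ht : DifferentiableSectionAt t x) (ht' : DifferentiableSectionAt t' x) :
    courant s (t + t') x = courant s t x + courant s t' x := by
  have hd (t : Π x : M, BigTangent m M x) (ht : DifferentiableSectionAt t x) :
      MDifferentiableAt (𝓡 m) 𝓘(ℝ, ℝ)
        (fun y => ((s y).2 (t y).1 - (t y).2 (s y).1 : ℝ)) x :=
    (hs.snd.mdifferentiableAt_apply ht.fst).sub (ht.snd.mdifferentiableAt_apply hs.fst)
  have mvfderiv_sub_add :
      mvfderiv (𝓡 m) (fun y => ((s y).2 ((t + t') y).1 - ((t + t') y).2 (s y).1 : ℝ)) x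
        = mvfderiv (𝓡 m) (fun y => ((s y).2 (t y).1 - (t y).2 (s y).1 : ℝ)) x
          + mvfderiv (𝓡 m) (fun y => ((s y).2 (t' y).1 - (t' y).2 (s y).1 : ℝ)) x := by
    rw [← mvfderiv_add (hd t ht) (hd t' ht')]
    congr 1
    funext y
    simp only [Pi.add_apply, Prod.fst_add, Prod.snd_add, map_add, add_apply]
    exact add_sub_add_comm _ _ _ _
  refine Prod.ext (VectorField.mlieBracket_add_right ht.fst ht'.fst) ?_
  change lieDerForm (fun y => (s y).1) ((fun y => (t y).2) + fun y => (t' y).2) x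
      - lieDerForm ((fun y => (t y).1) + fun y => (t' y).1) (fun y => (s y).2) x
      + (1 / 2 : ℝ) • mvfderiv (𝓡 m)
        (fun y => ((s y).2 ((t + t') y).1 - ((t + t') y).2 (s y).1 : ℝ)) x = _
  rw [mvfderiv_sub_add, lieDerForm_add_left ht.fst ht'.fst hs.snd,
    lieDerForm_add_right hs.fst ht.snd ht'.snd, Prod.snd_add, courant, courant]
  module

theorem gualtieriTorsion_add_right (hs : DifferentiableSectionAt s x)
    (ht : DifferentiableSectionAt t x) (ht' : DifferentiableSectionAt t' x)
    (r : Π x : M, BigTangent m M x) :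
    gualtieriTorsion nabla s (t + t') r x
      = gualtieriTorsion nabla s t r x + gualtieriTorsion nabla s t' r x := by
  have nabla_add (v : TangentSpace (𝓡 m) x) : nabla (t + t') x v = nabla t x v + nabla t' x v := by
    rw [nabla.isCovariantDerivativeOnUniv.add ht ht']
    rfl
  have nabla_apply_add : nabla s x ((t + t') x).1 = nabla s x (t x).1 + nabla s x (t' x).1 :=
    map_add (nabla s x) (t x).1 (t' x).1
  have courantTorsion_add : courantTorsion nabla s (t + t') x
      = courantTorsion nabla s t x + courantTorsion nabla s t' x := by
    rw [courantTorsion, nabla_add, nabla_apply_add, courant_add_right hs ht ht', courantTorsion,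
      courantTorsion]
    module
  rw [gualtieriTorsion, courantTorsion_add, nabla_add, Pi.add_apply, gualtieriTorsion,
    gualtieriTorsion]
  simp only [map_add, LinearMap.add_apply]
  ring

theorem gualtieriTorsion_add_left (hs : DifferentiableSectionAt s x)
    (hs' : DifferentiableSectionAt s' x) (ht : DifferentiableSectionAt t x)
    (r : Π x : M, BigTangent m M x) :
    gualtieriTorsion nabla (s + s') t r x
      = gualtieriTorsion nabla s t r x + gualtieriTorsion nabla s' t r x := by
  rw [gualtieriTorsion_swap, gualtieriTorsion_add_right ht hs hs', neg_add,
    ← gualtieriTorsion_swap, ← gualtieriTorsion_swap]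

end Additivity

section Integrability

variable {m : ℕ} {M : Type*} [TopologicalSpace M] [ChartedSpace (EuclideanSpace ℝ (Fin m)) M]
  [IsManifold (𝓡 m) ∞ M]

theorem SmoothSection.differentiableSectionAt {s : Π x : M, BigTangent m M x}
    (hs : SmoothSection s) (x : M) : DifferentiableSectionAt s x :=
  ContMDiffAt.mdifferentiableAt (hs x) (by simp)

theorem AlmostDirac.exists_section [T2Space M] (E : AlmostDirac m M) {x : M}
    {u : BigTangent m M x} (hu : u ∈ E.fiber x) : ∃ r, E.IsSection r ∧ r x = u := by
  obtain ⟨U, hU, hx, k, e, he, hspan⟩ := E.locallyFramed x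
  rw [← (hspan x hx).2, Submodule.mem_span_range_iff_exists_fun] at hu
  obtain ⟨c, hc⟩ := hu
  have local_smooth : SmoothSectionOn U fun y => ∑ i, c i • e i y :=
    ContMDiffOn.sum_section fun i _ => (he i).const_smul_section
  obtain ⟨ρ, hρx, hρU, hρ⟩ := exists_contMDiff_smul_section hU hx local_smooth
  refine ⟨fun y => ρ y • ∑ i, c i • e i y, ⟨hρ, fun y => ?_⟩, ?_⟩
  · by_cases hy : y ∈ U
    · rw [← (hspan y hy).2]
      exact Submodule.smul_mem _ _ <| Submodule.sum_mem _ fun i _ =>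
        Submodule.smul_mem _ _ <| Submodule.subset_span ⟨i, rfl⟩
    · change ρ y • ∑ i, c i • e i y ∈ E.fiber y
      rw [hρU y hy, zero_smul]
      exact zero_mem _
  · change ρ x • ∑ i, c i • e i x = u
    rw [hρx, one_smul, hc]

theorem AlmostDirac.integrable_iff [T2Space M] (E : AlmostDirac m M) :
    E.Integrable ↔ ∀ s t r, E.IsSection s → E.IsSection t → E.IsSection r →
      ∀ x, neutral x (courant s t x) (r x) = 0 := by
  constructor
  · intro hE s t r hs ht hr x
    exact (E.maximalIsotropic x).prop _ (hE s t hs ht x) _ (hr.2 x)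
  · intro h s t hs ht x
    rw [← E.orthogonal_fiber x]
    intro u hu
    obtain ⟨r, hr, rfl⟩ := E.exists_section hu
    exact (neutral_comm _ _).trans (h s t r hs ht hr x)

theorem AlmostDirac.gualtieriTorsion_eq_neg_neutral_courant {E : AlmostDirac m M}
    {nabla : CovariantDerivative (𝓡 m) (BigModel m) (BigTangent m M)}
    (hnabla : ∀ s, E.IsSection s → ∀ x v, nabla s x v ∈ E.fiber x)
    {s t r : Π x : M, BigTangent m M x} (hs : E.IsSection s) (ht : E.IsSection t)
    (hr : E.IsSection r) (x : M) :
    gualtieriTorsion nabla s t r x = -neutral x (courant s t x) (r x) := by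
  have isotropic (u v) (hu : u ∈ E.fiber x) (hv : v ∈ E.fiber x) : neutral x u v = 0 :=
    (E.maximalIsotropic x).prop u hu v hv
  rw [gualtieriTorsion, courantTorsion, map_sub, map_sub, LinearMap.sub_apply, LinearMap.sub_apply,
    isotropic _ _ (hnabla t ht x _) (hr.2 x), isotropic _ _ (hnabla s hs x _) (hr.2 x),
    isotropic _ _ (hnabla s hs x _) (ht.2 x), isotropic _ _ (hnabla t ht x _) (hs.2 x)]
  ring

theorem proposition3p4_general [T2Space M] (E : AlmostDirac m M)
    (Ψ : Π x : M, BigTangent m M x →ₗ[ℝ] BigTangent m M x)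
    (smooth_Ψ : ∀ s, SmoothSection s → SmoothSection fun x => Ψ x (s x))
    (Ψ_of_mem : ∀ x, ∀ u ∈ E.fiber x, Ψ x u = u) (add_Ψ_mem : ∀ x u, u + Ψ x u ∈ E.fiber x)
    (nabla : CovariantDerivative (𝓡 m) (BigModel m) (BigTangent m M))
    (hnabla : ∀ s, E.IsSection s → ∀ x v, nabla s x v ∈ E.fiber x) :
    (∀ s t r, SmoothSection s → SmoothSection t → E.IsSection r → ∀ x,
      gualtieriTorsion nabla s t r x + gualtieriTorsion nabla s (fun y => Ψ y (t y)) r x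
        + gualtieriTorsion nabla (fun y => Ψ y (s y)) t r x
        + gualtieriTorsion nabla (fun y => Ψ y (s y)) (fun y => Ψ y (t y)) r x = 0) ↔
      E.Integrable := by
  rw [E.integrable_iff]
  constructor
  · intro hT s t r hs ht hr x
    have hΨs : (fun y => Ψ y (s y)) = s := funext fun y => Ψ_of_mem y _ (hs.2 y)
    have hΨt : (fun y => Ψ y (t y)) = t := funext fun y => Ψ_of_mem y _ (ht.2 y)
    have four_torsion := hT s t r hs.1 ht.1 hr x
    rw [hΨs, hΨt, E.gualtieriTorsion_eq_neg_neutral_courant hnabla hs ht hr] at four_torsion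
    linarith
  · intro hE s t r hs ht hr x
    have isSection_add_Ψ (s) (hs : SmoothSection s) : E.IsSection (s + fun y => Ψ y (s y)) :=
      ⟨ContMDiff.add_section hs (smooth_Ψ s hs), fun y => add_Ψ_mem y (s y)⟩
    have ds := hs.differentiableSectionAt x
    have dt := ht.differentiableSectionAt x
    have dΨs := (smooth_Ψ s hs).differentiableSectionAt x
    have dΨt := (smooth_Ψ t ht).differentiableSectionAt x
    have torsion_add_Ψ := E.gualtieriTorsion_eq_neg_neutral_courant hnabla
      (isSection_add_Ψ s hs) (isSection_add_Ψ t ht) hr x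
    rw [hE _ _ _ (isSection_add_Ψ s hs) (isSection_add_Ψ t ht) hr x, neg_zero,
      gualtieriTorsion_add_left ds dΨs (dt.add dΨt), gualtieriTorsion_add_right ds dt dΨt,
      gualtieriTorsion_add_right dΨs dt dΨt, ← add_assoc] at torsion_add_Ψ
    exact torsion_add_Ψ

end Integrability

end GeneralizedGeometry

open GeneralizedGeometry in
theorem proposition3p4 {m : ℕ} {M : Type*} [TopologicalSpace M]
    [ChartedSpace (EuclideanSpace ℝ (Fin m)) M] [IsManifold (𝓡 m) ∞ M]
    [T2Space M] [SecondCountableTopology M]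
    (G : GenRiemannianMetric m M) (E : AlmostDirac m M) :
    ((∃ D : BigConnection m M, D.Preserves E ∧ D.TorsionIdentity G E) → E.Integrable) ∧
      (E.Integrable → ∀ D : BigConnection m M, D.Preserves E → D.TorsionIdentity G E) := by
  have torsionIdentity_iff (D : BigConnection m M) (hD : D.Preserves E) :
      D.TorsionIdentity G E ↔ E.Integrable :=
    proposition3p4_general E (E.para G) (fun _ => E.smoothSection_para G)
      (fun _ _ => E.para_of_mem G) (fun _ => E.add_para_mem G) D.cov hD
  exact ⟨fun ⟨D, hD, hT⟩ => (torsionIdentity_iff D hD).1 hT,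
    fun hE D hD => (torsionIdentity_iff D hD).2 hE⟩
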